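/- All graphs are finite and simple. A perfect matching of a graph $G$ is a set of edges of $G$ such that every vertex of $G$ lies in exactly one of them. A graph is \emph{matching covered} if it is connected and each of its edges lies in a perfect matching. For a matching covered graph $G$ and $X\subseteq V(G)$, let $\partial(X)$ be the set of edges of $G$ joining a vertex of $X$ to a vertex of $V(G)\setminus X$, and let the \emph{matching porosity} of $\partial(X)$ be $$\operatorname{mp}(\partial(X)) := \max\{\,|M\cap\partial(X)| : M \text{ a perfect matching of } G\,\}.$$ A \emph{perfect matching decomposition} of $G$ is a pair $(T,\delta)$ where $T$ is a cubic tree (a finite tree all of whose inner vertices have degree three) and $\delta$ is a bijection from the set of leaves of $T$ to $V(G)$ (the vertex of a one-vertex tree counts as a leaf). For an edge $e=tt'$ of $T$, let $\partial(e):=\partial(X)$, where $X$ is the image under $\delta$ of the set of those leaves of $T$ that lie in the component of $T-e$ containing $t$. The \emph{perfect matching width} of $G$ is $$\operatorname{pmw}(G) := \min_{(T,\delta)}\ \max_{e\in E(T)} \operatorname{mp}(\partial(e)),$$ the minimum being over all perfect matching decompositions of $G$ (a maximum over the empty set is $0$). \emph{Bicontracting} a vertex $v_0$ of degree two with neighbours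 $v_1,v_2$ means contracting both edges $v_0v_1$ and $v_0v_2$ and deleting all resulting loops and parallel edges. A subgraph $K$ of $G$ is \emph{conformal} if $G-V(K)$ has a perfect matching (which holds if $V(K)=V(G)$). A graph $H$ is a \emph{matching minor} of $G$ if $H$ can be obtained, up to isomorphism, from a conformal subgraph of $G$ by repeatedly (possibly zero times) bicontracting vertices of degree two. \textbf{Proposition.} Let $G$ and $H$ be matching covered bipartite graphs. If $H$ is a matching minor of $G$, then $\operatorname{pmw}(H)\le 2\operatorname{pmw}(G)$. -/

import Mathlib

universe u v

namespace PMWidth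

/-- A graph is matching covered if it is connected and each of its edges lies in a perfect
matching. -/
def MatchingCovered {V : Type u} (G : SimpleGraph V) : Prop :=
  G.Connected ∧ ∀ e ∈ G.edgeSet, ∃ M : G.Subgraph, M.IsPerfectMatching ∧ e ∈ M.edgeSet

/-- The cut at `X`: all edges of `G` joining a vertex of `X` to a vertex outside `X`. -/
def cut {V : Type u} (G : SimpleGraph V) (X : Set V) : Set (Sym2 V) :=
  {e | e ∈ G.edgeSet ∧ ∃ x ∈ X, ∃ y ∉ X, e = s(x, y)}

/-- The matching porosity of the cut at `X`: the maximum, over all perfect matchings `M` of `G`,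
of the number of edges of `M` in the cut. -/
noncomputable def matchingPorosity {V : Type u} (G : SimpleGraph V) (X : Set V) : ℕ∞ :=
  ⨆ (M : G.Subgraph) (_ : M.IsPerfectMatching), (M.edgeSet ∩ cut G X).encard

/-- A leaf of a tree on `Fin n`: a vertex of degree one. The only vertex of the one-vertex tree
counts as a leaf, too. -/
def IsLeaf {n : ℕ} (T : SimpleGraph (Fin n)) (t : Fin n) : Prop :=
  (T.neighborSet t).ncard ≤ 1

/-- A perfect matching decomposition of a graph with vertex set `V`: a (finite) cubic tree, that
is, a tree all of whose inner vertices have degree three, together with a bijection `δ` from its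
leaves to `V`. -/
structure Decomposition (V : Type u) where
  /-- number of vertices of the tree -/
  n : ℕ
  /-- the tree -/
  T : SimpleGraph (Fin n)
  isTree : T.IsTree
  cubic : ∀ t, ¬ IsLeaf T t → (T.neighborSet t).ncard = 3
  /-- the bijection from the leaves to the vertices -/
  δ : {t : Fin n // IsLeaf T t} ≃ V

/-- The shore belonging to `t` of the cut induced by an edge `tt'` of the tree: the vertices that
`δ` assigns to the leaves in the component of `T - tt'` containing `t`. -/
def Decomposition.shore {V : Type u} (D : Decomposition V) (t t' : Fin D.n) : Set V :=
  {x | (D.T.deleteEdges {s(t, t')}).Reachable t (D.δ.symm x)}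

/-- The width of a decomposition: the maximum matching porosity over the cuts induced by the edges
of the tree. (Both orientations `tt'`, `t't` of an edge induce the same cut.) -/
noncomputable def Decomposition.width {V : Type u} (D : Decomposition V) (G : SimpleGraph V) :
    ℕ∞ :=
  ⨆ (t : Fin D.n) (t' : Fin D.n) (_ : D.T.Adj t t'), matchingPorosity G (D.shore t t')

/-- The perfect matching width: the minimum width of a perfect matching decomposition. -/
noncomputable def pmw {V : Type u} (G : SimpleGraph V) : ℕ∞ :=
  ⨅ D : Decomposition V, D.width G

/-- `H` is (a copy of) the graph obtained from `G` by bicontracting a vertex `v₀` of degree two with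
neighbours `v₁`, `v₂`: the edges `v₀v₁` and `v₀v₂` are contracted, and resulting parallel edges
(and a loop, if `v₁v₂` is an edge) are deleted. The map `f` is the contraction map. -/
def IsBicontraction {V : Type u} {W : Type v} (G : SimpleGraph V) (H : SimpleGraph W) : Prop :=
  ∃ (v₀ v₁ v₂ : V) (f : V → W),
    v₁ ≠ v₂ ∧ G.neighborSet v₀ = {v₁, v₂} ∧
    Function.Surjective f ∧
    (∀ x y, f x = f y ↔
      x = y ∨ (x ∈ ({v₀, v₁, v₂} : Set V) ∧ y ∈ ({v₀, v₁, v₂} : Set V))) ∧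
    (∀ a b, H.Adj a b ↔ a ≠ b ∧ ∃ x y, f x = a ∧ f y = b ∧ G.Adj x y)

/-- `BicontractsTo H G`: `H` is, up to isomorphism, obtained from `G` by a (possibly empty) sequence
of bicontractions of vertices of degree two. -/
inductive BicontractsTo {W : Type v} (H : SimpleGraph W) :
    {V : Type u} → SimpleGraph V → Prop
  | iso {V : Type u} {G : SimpleGraph V} (e : G ≃g H) : BicontractsTo H G
  | step {V V' : Type u} {G : SimpleGraph V} {G' : SimpleGraph V'}
      (h : IsBicontraction G G') (h' : BicontractsTo H G') : BicontractsTo H G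

/-- A subgraph `K` of `G` is conformal if `G - V(K)` has a perfect matching. -/
def Conformal {V : Type u} {G : SimpleGraph V} (K : G.Subgraph) : Prop :=
  ∃ M : (G.induce K.vertsᶜ).Subgraph, M.IsPerfectMatching

/-- `H` is a matching minor of `G` if it can be obtained from a conformal subgraph of `G` by
repeatedly bicontracting vertices of degree two. -/
def IsMatchingMinor {W : Type v} {V : Type u} (H : SimpleGraph W) (G : SimpleGraph V) : Prop :=
  ∃ K : G.Subgraph, Conformal K ∧ BicontractsTo H K.coe

end PMWidth

namespace PMWidth

/-! A decomposition of `G` is pulled back to `H` along a map that identifies the ends of every edge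
of a fixed perfect matching `m'` of `H`. This `m'` lifts to a perfect matching `m` of `G` along an
embedding `ι` of the vertices of `H` (`Lifts`), and `φ` sends both ends of an `m'`-edge to the image
under `ι` of its end of colour `true`. A shore `X` in `G` becomes `φ ⁻¹' X`.

Let `n'` be a perfect matching of `H`, lifted to `n`. For `a` of colour `true`, `φ (n' a) = ι (m'
(n' a))`, so the `n'`-edges crossing `φ ⁻¹' X` are the steps of the permutation `m' ∘ n'` crossing
`ι ⁻¹' X`. The lift is such that `m ∘ n` crosses `X` at least as often. A step of `m ∘ n` is an
`n`-edge followed by an `m`-edge, so there are at most twice width many crossings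
(`crossing_comp_le`).

Nonempty fibres of `φ` are `m'`-edges; they are split further into singletons, of porosity at most
one. The resulting sets are recorded by `Good`, turned into a laminar family, and the Hasse diagram
of this family is the cubic tree of the new decomposition (`IsFamily.exists_decomposition`). -/

/-! ### Perfect matchings as fixed-point-free involutions -/

/-- `m` sends every vertex to its partner in a perfect matching of `G`. -/
structure IsMate {V : Type u} (G : SimpleGraph V) (m : V → V) : Prop where
  adj : ∀ v, G.Adj v (m v)
  invol : ∀ v, m (m v) = v

lemma IsMate.injective {V : Type u} {G : SimpleGraph V} {m : V → V} (hm : IsMate G m) :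
    Function.Injective m :=
  Function.LeftInverse.injective hm.invol

lemma exists_isMate {V : Type u} {G : SimpleGraph V} {M : G.Subgraph}
    (hM : M.IsPerfectMatching) : ∃ m, IsMate G m ∧ ∀ v w, M.Adj v w ↔ m v = w := by
  rw [SimpleGraph.Subgraph.isPerfectMatching_iff] at hM
  choose m hm hu using hM
  have key : ∀ v w, M.Adj v w ↔ m v = w :=
    fun v w => ⟨fun h => (hu v w h).symm, fun h => h ▸ hm v⟩
  exact ⟨m, ⟨fun v => (hm v).adj_sub, fun v => (key _ _).1 (hm v).symm⟩, key⟩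

lemma IsMate.exists_subgraph {V : Type u} {G : SimpleGraph V} {m : V → V} (hm : IsMate G m) :
    ∃ M : G.Subgraph, M.IsPerfectMatching ∧ ∀ v w, M.Adj v w ↔ m v = w := by
  refine ⟨⟨Set.univ, fun v w => m v = w, ?_, fun _ => Set.mem_univ _, ?_⟩, ?_, fun v w => Iff.rfl⟩
  · rintro v w rfl
    exact hm.adj v
  · refine ⟨?_⟩
    rintro v w rfl
    exact hm.invol v
  · rw [SimpleGraph.Subgraph.isPerfectMatching_iff]
    exact fun v => ⟨m v, rfl, fun w hw => Eq.symm hw⟩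

/-- A proper two-colouring. -/
def IsColouring {V : Type u} (G : SimpleGraph V) (c : V → Bool) : Prop :=
  ∀ v w, G.Adj v w → c w = !c v

lemma exists_isColouring {V : Type u} {G : SimpleGraph V} (hG : G.IsBipartite) :
    ∃ c, IsColouring G c := by
  obtain ⟨C⟩ := hG
  refine ⟨fun v => decide (C v = 0), fun v w h => ?_⟩
  have key : ∀ i j : Fin 2, i ≠ j → decide (j = 0) = !decide (i = 0) := by decide
  exact key _ _ (C.valid h)

/-- The number of vertices `a` of colour `true` such that `X` separates `a` from `σ a`. -/
noncomputable def crossing {V : Type u} (c : V → Bool) (σ : V → V) (X : Set V) : ℕ∞ :=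
  {a | c a = true ∧ (a ∈ X ↔ σ a ∉ X)}.encard

/-- Every matching edge has exactly one end of colour `true`, so counting these ends counts the
edges. With `matchingPorosity_le` this replaces porosity by a count that also makes sense for
permutations such as `m ∘ n`. -/
lemma crossing_le_matchingPorosity {V : Type u} {G : SimpleGraph V} {c : V → Bool} {m : V → V}
    (hc : IsColouring G c) (hm : IsMate G m) (X : Set V) :
    crossing c m X ≤ matchingPorosity G X := by
  obtain ⟨M, hM, hMm⟩ := hm.exists_subgraph
  refine le_trans ?_ (le_iSup₂ (f := fun (M : G.Subgraph) (_ : M.IsPerfectMatching) =>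
    (M.edgeSet ∩ cut G X).encard) M hM)
  refine Set.encard_le_encard_of_injOn (f := fun a => s(a, m a)) ?_ ?_
  · rintro a ⟨-, ha⟩
    refine ⟨(hMm _ _).2 rfl, hm.adj a, ?_⟩
    by_cases h : a ∈ X
    · exact ⟨a, h, m a, ha.1 h, rfl⟩
    · exact ⟨m a, by tauto, a, h, Sym2.eq_swap⟩
  · rintro a ⟨ha, -⟩ b ⟨hb, -⟩ hab
    rcases Sym2.eq_iff.1 hab with h | ⟨h, -⟩
    · exact h.1
    · have := hc _ _ (hm.adj b)
      simp_all

lemma matchingPorosity_le {V : Type u} {G : SimpleGraph V} {c : V → Bool}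
    (hc : IsColouring G c) {X : Set V} {k : ℕ∞}
    (h : ∀ m, IsMate G m → crossing c m X ≤ k) : matchingPorosity G X ≤ k := by
  refine iSup₂_le fun M hM => ?_
  obtain ⟨m, hm, hMm⟩ := exists_isMate hM
  refine le_trans ?_ (h m hm)
  refine le_trans (Set.encard_le_encard ?_) (Set.encard_image_le (fun a => s(a, m a)) _)
  rintro e ⟨heM, -, x, hx, y, hy, rfl⟩
  have hxy : m x = y := (hMm _ _).1 heM
  have hyx : m y = x := by rw [← hxy, hm.invol]
  cases hcx : c x
  · refine ⟨y, ⟨?_, ?_⟩, ?_⟩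
    · rw [← hxy, hc _ _ (hm.adj x), hcx]; rfl
    · rw [hyx]; tauto
    · simp only [hyx]; exact Sym2.eq_swap
  · refine ⟨x, ⟨hcx, ?_⟩, ?_⟩
    · rw [hxy]; tauto
    · simp only [hxy]

lemma cut_compl {V : Type u} (G : SimpleGraph V) (X : Set V) : cut G Xᶜ = cut G X := by
  ext e
  constructor
  · rintro ⟨he, x, hx, y, hy, rfl⟩
    exact ⟨he, y, by simpa using hy, x, hx, Sym2.eq_swap⟩
  · rintro ⟨he, x, hx, y, hy, rfl⟩
    exact ⟨he, y, hy, x, by simpa using hx, Sym2.eq_swap⟩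

lemma matchingPorosity_compl {V : Type u} (G : SimpleGraph V) (X : Set V) :
    matchingPorosity G Xᶜ = matchingPorosity G X := by
  simp only [matchingPorosity, cut_compl]

lemma matchingPorosity_singleton_le {V : Type u} {G : SimpleGraph V} {c : V → Bool}
    (hc : IsColouring G c) (v : V) : matchingPorosity G {v} ≤ 1 := by
  refine matchingPorosity_le hc fun m hm => ?_
  refine Set.encard_le_one_iff.2 ?_
  have key : ∀ a, c a = true → (a ∈ ({v} : Set V) ↔ m a ∉ ({v} : Set V)) →
      a = if c v then v else m v := by
    intro a ha h
    simp only [Set.mem_singleton_iff] at h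
    by_cases hav : a = v
    · rw [← hav, ha, if_pos rfl]
    · have : m a = v := by tauto
      have h2 := hc _ _ (hm.adj a)
      rw [← this, h2, ha, hm.invol]
      rfl
  rintro a b ⟨ha, ha'⟩ ⟨hb, hb'⟩
  rw [key a ha ha', key b hb hb']

lemma one_le_matchingPorosity_singleton {V : Type u} {G : SimpleGraph V} {c : V → Bool}
    {m : V → V} (hc : IsColouring G c) (hm : IsMate G m) (v : V) :
    1 ≤ matchingPorosity G {v} := by
  refine le_trans ?_ (crossing_le_matchingPorosity hc hm {v})
  rw [crossing, Set.one_le_encard_iff_nonempty]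
  have hne : m v ≠ v := (hm.adj v).ne'
  cases hcv : c v
  · refine ⟨m v, by rw [hc _ _ (hm.adj v), hcv]; rfl, ?_⟩
    simp [hm.invol, hne]
  · exact ⟨v, hcv, by simp [hne]⟩

/-- The source of the factor two: if `X` separates `a` from `m (n a)`, then one of the edges from
`a` to `n a` and from `n a` to `m (n a)` crosses. The second is charged to `m (n a)`, which again
has colour `true`. -/
lemma crossing_comp_le {V : Type u} {G : SimpleGraph V} {c : V → Bool} {m n : V → V}
    (hc : IsColouring G c) (hm : IsMate G m) (hn : IsMate G n) (X : Set V) :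
    crossing c (m ∘ n) X ≤ crossing c n X + crossing c m X := by
  have hsub : {a | c a = true ∧ (a ∈ X ↔ (m ∘ n) a ∉ X)} ⊆
      {a | c a = true ∧ (a ∈ X ↔ n a ∉ X)} ∪
        (m ∘ n) ⁻¹' {a | c a = true ∧ (a ∈ X ↔ m a ∉ X)} := by
    rintro a ⟨ha, h⟩
    by_cases h1 : a ∈ X ↔ n a ∉ X
    · exact Or.inl ⟨ha, h1⟩
    · refine Or.inr ⟨?_, ?_⟩
      · simp [hc _ _ (hm.adj _), hc _ _ (hn.adj _), ha]
      · simp only [Function.comp_apply, hm.invol] at h ⊢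
        tauto
  refine (Set.encard_le_encard hsub).trans ((Set.encard_union_le _ _).trans ?_)
  refine add_le_add le_rfl ?_
  exact Set.encard_le_encard_of_injOn (f := m ∘ n) (fun a ha => ha)
    (hm.injective.comp hn.injective).injOn

/-- If `σ'` is the first return map of `σ` to the range of `ι`, where returning takes at most two
steps, then a set is crossed by `σ` at least as often as its preimage is crossed by `σ'`. -/
lemma crossing_preimage_le {V : Type u} {W : Type v} {c : V → Bool} {c' : W → Bool}
    {σ : V → V} {σ' : W → W} {ι : W → V} (hσ : Function.Injective σ) (hι : Function.Injective ι)
    (hσc : ∀ x, c (σ x) = c x) (hιc : ∀ x, c (ι x) = c' x)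
    (h : ∀ s, σ (ι s) = ι (σ' s) ∨ (σ (ι s) ∉ Set.range ι ∧ σ (σ (ι s)) = ι (σ' s)))
    (X : Set V) : crossing c' σ' (ι ⁻¹' X) ≤ crossing c σ X := by
  classical
  -- A crossing of `σ'` is charged to the step of `σ` at which it happens. If that is the second
  -- step, the charged vertex lies outside the range of `ι`, so it cannot collide with a vertex
  -- charged for a first step.
  refine Set.encard_le_encard_of_injOn
    (f := fun s => if ι s ∈ X ↔ σ (ι s) ∉ X then ι s else σ (ι s)) ?_ ?_
  · rintro s ⟨hs, hsX⟩
    simp only [Set.mem_preimage] at hsX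
    dsimp only
    split_ifs with h1
    · exact ⟨by rw [hιc, hs], h1⟩
    · refine ⟨by rw [hσc, hιc, hs], ?_⟩
      rcases h s with h2 | ⟨-, h2⟩
      · rw [h2] at h1; exact absurd hsX h1
      · rw [h2]; tauto
  · have hr : ∀ s, s ∈ {a | c' a = true ∧ (a ∈ ι ⁻¹' X ↔ σ' a ∉ ι ⁻¹' X)} →
        ¬ (ι s ∈ X ↔ σ (ι s) ∉ X) → σ (ι s) ∉ Set.range ι := by
      rintro s ⟨-, hsX⟩ h1
      simp only [Set.mem_preimage] at hsX
      rcases h s with h2 | ⟨h2, -⟩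
      · rw [h2] at h1; exact absurd hsX h1
      · exact h2
    intro s hs t ht hst
    dsimp only at hst
    split_ifs at hst with h1 h2 h2
    · exact hι hst
    · exact absurd ⟨s, hst⟩ (hr t ht h2)
    · exact absurd ⟨t, hst.symm⟩ (hr s hs h1)
    · exact hι (hσ hst)

/-! ### Lifting perfect matchings along bicontractions -/

/-- `ι` embeds `H` into `G` in such a way that every perfect matching `n'` of `H` lifts to a perfect
matching of `G`, compatibly with the perfect matchings `m'` and `m`. -/
structure IsLift {V : Type u} {W : Type v} (G : SimpleGraph V) (H : SimpleGraph W)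
    (c : V → Bool) (c' : W → Bool) (m : V → V) (m' : W → W) (ι : W → V) : Prop where
  mate : IsMate G m
  injective : Function.Injective ι
  colour : ∀ w, c (ι w) = c' w
  lift : ∀ n', IsMate H n' → ∃ n, IsMate G n ∧
    ∀ X, crossing c' (m' ∘ n') (ι ⁻¹' X) ≤ crossing c (m ∘ n) X

/-- Every perfect matching of `H` lifts to `G`, for a suitable two-colouring of `H`. -/
def Lifts {V : Type u} {W : Type v} (G : SimpleGraph V) (H : SimpleGraph W)
    (c : V → Bool) (c' : W → Bool) : Prop :=
  ∀ m', IsMate H m' → ∃ m ι, IsLift G H c c' m m' ι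

lemma Lifts.trans {V₁ V₂ V₃ : Type*} {G₁ : SimpleGraph V₁} {G₂ : SimpleGraph V₂}
    {G₃ : SimpleGraph V₃} {c₁ : V₁ → Bool} {c₂ : V₂ → Bool} {c₃ : V₃ → Bool}
    (h : Lifts G₁ G₂ c₁ c₂) (h' : Lifts G₂ G₃ c₂ c₃) : Lifts G₁ G₃ c₁ c₃ := by
  intro m₃ hm₃
  obtain ⟨m₂, ι₂, h₂⟩ := h' m₃ hm₃
  obtain ⟨m₁, ι₁, h₁⟩ := h m₂ h₂.mate
  refine ⟨m₁, ι₁ ∘ ι₂, h₁.mate, h₁.injective.comp h₂.injective,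
    fun w => by rw [Function.comp_apply, h₁.colour, h₂.colour], fun n₃ hn₃ => ?_⟩
  obtain ⟨n₂, hn₂, hX₂⟩ := h₂.lift n₃ hn₃
  obtain ⟨n₁, hn₁, hX₁⟩ := h₁.lift n₂ hn₂
  exact ⟨n₁, hn₁, fun X => (hX₂ (ι₁ ⁻¹' X)).trans (hX₁ X)⟩

lemma colour_comp {V : Type u} {G : SimpleGraph V} {c : V → Bool} {m n : V → V}
    (hc : IsColouring G c) (hm : IsMate G m) (hn : IsMate G n) (x : V) :
    c ((m ∘ n) x) = c x := by
  simp [hc _ _ (hm.adj _), hc _ _ (hn.adj _)]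

/-- Return times can add up under repeated bicontraction, whereas the crossing inequality in
`IsLift` composes; so the two-step return is only required of a single operation. -/
lemma isLift_of_return {V : Type u} {W : Type v} {G : SimpleGraph V} {H : SimpleGraph W}
    {c : V → Bool} {c' : W → Bool} {m : V → V} {m' : W → W} {ι : W → V}
    (hc : IsColouring G c) (hm : IsMate G m) (hι : Function.Injective ι)
    (hιc : ∀ w, c (ι w) = c' w)
    (h : ∀ n', IsMate H n' → ∃ n, IsMate G n ∧ ∀ s, m (n (ι s)) = ι (m' (n' s)) ∨
      (m (n (ι s)) ∉ Set.range ι ∧ m (n (m (n (ι s)))) = ι (m' (n' s)))) :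
    IsLift G H c c' m m' ι := by
  refine ⟨hm, hι, hιc, fun n' hn' => ?_⟩
  obtain ⟨n, hn, hr⟩ := h n' hn'
  exact ⟨n, hn, fun X => crossing_preimage_le (hm.injective.comp hn.injective) hι
    (colour_comp hc hm hn) hιc hr X⟩

lemma exists_lifts_of_iso {V : Type u} {W : Type v} {G : SimpleGraph V} {H : SimpleGraph W}
    (e : G ≃g H) {c : V → Bool} (hc : IsColouring G c) :
    ∃ c', IsColouring H c' ∧ Lifts G H c c' := by
  have hmate : ∀ n', IsMate H n' → IsMate G (fun v => e.symm (n' (e v))) := by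
    intro n' hn'
    refine ⟨fun v => ?_, fun v => ?_⟩
    · rw [← e.map_adj_iff]
      simpa using hn'.adj (e v)
    · simp [hn'.invol]
  refine ⟨fun w => c (e.symm w), fun v w h => hc _ _ (e.symm.map_adj_iff.2 h), fun m' hm' =>
    ⟨_, e.symm, isLift_of_return hc (hmate m' hm') e.symm.injective (fun _ => rfl)
      fun n' hn' => ⟨_, hmate n' hn', fun s => Or.inl ?_⟩⟩⟩
  simp

section Bicontraction

variable {V : Type u} {W : Type v} {G : SimpleGraph V} {H : SimpleGraph W}

/-- The perfect matching of `G` lifting the perfect matching `m` of the bicontraction `f` of `v₀`,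
where `q` is the neighbour of `v₀` that is matched to it. -/
noncomputable def liftMate (f : V → W) (v₀ q : V) (ι : W → V) (m : W → W) (x : V) : V :=
  open Classical in if x = v₀ then q else if x = q then v₀ else ι (m (f x))

/-- `ι` is a section of the bicontraction `f` of `v₀` that avoids `v₀` and its neighbour `q`. -/
structure IsSection (f : V → W) (v₀ q : V) (ι : W → V) : Prop where
  ne : q ≠ v₀
  map : ∀ w, f (ι w) = w
  ne₀ : ∀ w, ι w ≠ v₀
  ne₁ : ∀ w, ι w ≠ q
  map_map : ∀ x, x ≠ v₀ → x ≠ q → ι (f x) = x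

variable {f : V → W} {v₀ q : V} {ι : W → V}

lemma liftMate_self (m : W → W) : liftMate f v₀ q ι m v₀ = q := by simp [liftMate]

lemma IsSection.liftMate_neighbour (h : IsSection f v₀ q ι) (m : W → W) :
    liftMate f v₀ q ι m q = v₀ := by simp [liftMate, h.ne]

lemma IsSection.liftMate_map (h : IsSection f v₀ q ι) (m : W → W) (w : W) :
    liftMate f v₀ q ι m (ι w) = ι (m w) := by simp [liftMate, h.ne₀, h.ne₁, h.map]

lemma IsSection.isMate (h : IsSection f v₀ q ι) (hq : G.Adj v₀ q) {m : W → W}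
    (hm : IsMate H m) (hadj : ∀ w, G.Adj (ι w) (ι (m w))) :
    IsMate G (liftMate f v₀ q ι m) := by
  have hx : ∀ x, x = v₀ ∨ x = q ∨ ∃ w, x = ι w := fun x => by
    by_cases h0 : x = v₀
    · exact Or.inl h0
    by_cases h1 : x = q
    · exact Or.inr (Or.inl h1)
    exact Or.inr (Or.inr ⟨f x, (h.map_map x h0 h1).symm⟩)
  refine ⟨fun x => ?_, fun x => ?_⟩ <;> rcases hx x with rfl | rfl | ⟨w, rfl⟩
  · rwa [liftMate_self]
  · rw [h.liftMate_neighbour]; exact hq.symm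
  · rw [h.liftMate_map]; exact hadj w
  · rw [liftMate_self, h.liftMate_neighbour]
  · rw [h.liftMate_neighbour, liftMate_self]
  · rw [h.liftMate_map, h.liftMate_map, hm.invol]

end Bicontraction

/-- A perfect matching of `H` covers the contracted vertex by an edge at `v₁` or at `v₂`; its lift
matches `v₀` to the other one. If `m'` and `n'` agree in this choice, `m ∘ n` restricts to `m' ∘
n'`. Otherwise passing through the contracted vertex costs `m ∘ n` one extra step, via `v₀`. -/
lemma exists_lifts_of_isBicontraction {V : Type u} {W : Type v} {G : SimpleGraph V}
    {H : SimpleGraph W} (h : IsBicontraction G H) {c : V → Bool} (hc : IsColouring G c) :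
    ∃ c', IsColouring H c' ∧ Lifts G H c c' := by
  classical
  obtain ⟨v₀, v₁, v₂, f, h12, hN, hsurj, hf, hH⟩ := h
  have a1 : G.Adj v₀ v₁ := by
    have : v₁ ∈ G.neighborSet v₀ := by rw [hN]; simp
    exact this
  have a2 : G.Adj v₀ v₂ := by
    have : v₂ ∈ G.neighborSet v₀ := by rw [hN]; simp
    exact this
  have aN : ∀ x, G.Adj v₀ x → x = v₁ ∨ x = v₂ := fun x hx => by
    have : x ∈ G.neighborSet v₀ := hx
    rw [hN] at this
    simpa using this
  set w₀ := f v₀ with hw₀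
  have hf1 : f v₁ = w₀ := (hf _ _).2 (Or.inr (by simp))
  have hf2 : f v₂ = w₀ := (hf _ _).2 (Or.inr (by simp))
  have hfw : ∀ x, f x = w₀ → x = v₀ ∨ x = v₁ ∨ x = v₂ := fun x hx => by
    rcases (hf _ _).1 hx with h | ⟨h, -⟩
    · exact Or.inl h
    · simpa using h
  have hfi : ∀ x y, f x = f y → f x ≠ w₀ → x = y := fun x y hxy hx => by
    rcases (hf _ _).1 hxy with h | ⟨h, -⟩
    · exact h
    · exfalso; apply hx
      simp only [Set.mem_insert_iff, Set.mem_singleton_iff] at h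
      rcases h with rfl | rfl | rfl
      exacts [rfl, hf1, hf2]
  obtain ⟨g, hg⟩ : ∃ g : W → V, ∀ w, f (g w) = w := ⟨_, Function.surjInv_eq hsurj⟩
  -- the two sections of the contraction map
  have hsec : ∀ p q, (p = v₁ ∧ q = v₂ ∨ p = v₂ ∧ q = v₁) →
      IsSection f v₀ q (Function.update g w₀ p) := by
    intro p q hpq
    have hfp : f p = w₀ := by rcases hpq with ⟨rfl, -⟩ | ⟨rfl, -⟩ <;> assumption
    have hfq : f q = w₀ := by rcases hpq with ⟨-, rfl⟩ | ⟨-, rfl⟩ <;> assumption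
    have hp0 : p ≠ v₀ := by rcases hpq with ⟨rfl, -⟩ | ⟨rfl, -⟩; exacts [a1.ne', a2.ne']
    have hq0 : q ≠ v₀ := by rcases hpq with ⟨-, rfl⟩ | ⟨-, rfl⟩; exacts [a2.ne', a1.ne']
    have hpq' : p ≠ q := by
      rcases hpq with ⟨rfl, rfl⟩ | ⟨rfl, rfl⟩; exacts [h12, h12.symm]
    have hmap : ∀ w, f (Function.update g w₀ p w) = w := fun w => by
      by_cases hw : w = w₀
      · subst hw; rw [Function.update_self, hfp]
      · rw [Function.update_of_ne hw, hg]
    refine ⟨hq0, hmap, fun w hw => ?_, fun w hw => ?_, fun x hx0 hxq => ?_⟩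
    · have : w = w₀ := by rw [← hmap w, hw]
      subst this
      rw [Function.update_self] at hw; exact hp0 hw
    · have : w = w₀ := by rw [← hmap w, hw, hfq]
      subst this
      rw [Function.update_self] at hw; exact hpq' hw
    · by_cases hw : f x = w₀
      · rw [hw, Function.update_self]
        rcases hfw x hw with h | h | h
        · exact absurd h hx0
        all_goals rcases hpq with ⟨rfl, rfl⟩ | ⟨rfl, rfl⟩
        all_goals first | exact h.symm | exact absurd h hxq
      · exact hfi _ _ (hmap _) (by rwa [hmap])
  -- every perfect matching of the contraction lifts
  have hlift : ∀ m, IsMate H m → ∃ p q, (p = v₁ ∧ q = v₂ ∨ p = v₂ ∧ q = v₁) ∧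
      IsMate G (liftMate f v₀ q (Function.update g w₀ p) m) := by
    intro m hm
    obtain ⟨hne, x, y, hx, hy, hxy⟩ := (hH _ _).1 (hm.adj w₀)
    -- All neighbours of `v₀` are contracted with it, so the edge leaving the contracted vertex
    -- starts at `v₁` or `v₂`.
    have hx0 : x ≠ v₀ := by
      rintro rfl
      apply hne
      rw [← hy]
      rcases aN y hxy with rfl | rfl
      exacts [hf1.symm, hf2.symm]
    have hgy : g (m w₀) = y := hfi _ _ ((hg _).trans hy.symm) (by rw [hg]; exact hne.symm)
    obtain ⟨q, hq⟩ : ∃ q, (x = v₁ ∧ q = v₂ ∨ x = v₂ ∧ q = v₁) := by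
      rcases hfw x hx with h | h | h
      · exact absurd h hx0
      · exact ⟨v₂, Or.inl ⟨h, rfl⟩⟩
      · exact ⟨v₁, Or.inr ⟨h, rfl⟩⟩
    refine ⟨x, q, hq, (hsec x q hq).isMate ?_ hm ?_⟩
    · rcases hq with ⟨-, rfl⟩ | ⟨-, rfl⟩ <;> assumption
    · have hw0 : G.Adj (Function.update g w₀ x w₀) (Function.update g w₀ x (m w₀)) := by
        rw [Function.update_self, Function.update_of_ne hne.symm, hgy]
        exact hxy
      intro w
      by_cases h1 : w = w₀
      · rw [h1]; exact hw0
      by_cases h2 : m w = w₀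
      · have : w = m w₀ := by rw [← h2, hm.invol]
        rw [h2, this]; exact hw0.symm
      obtain ⟨-, a, b, ha, hb, hab⟩ := (hH _ _).1 (hm.adj w)
      rw [Function.update_of_ne h1, Function.update_of_ne h2]
      rwa [hfi (g w) a ((hg _).trans ha.symm) (by rwa [hg]),
        hfi (g (m w)) b ((hg _).trans hb.symm) (by rwa [hg])]
  have hc12 : c v₁ = c v₂ := by rw [hc _ _ a1, hc _ _ a2]
  set c' : W → Bool := fun w => c (Function.update g w₀ v₁ w) with hc'
  have hcol : ∀ x, x ≠ v₀ → c x = c' (f x) := by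
    intro x hx
    by_cases hw : x = v₂
    · subst hw
      simp only [hc', hf2, Function.update_self, hc12]
    · simp only [hc', (hsec v₁ v₂ (Or.inl ⟨rfl, rfl⟩)).map_map x hx hw]
  refine ⟨c', ?_, ?_⟩
  · intro a b hab
    obtain ⟨hne, x, y, rfl, rfl, hxy⟩ := (hH _ _).1 hab
    have key : ∀ x y, f x ≠ f y → G.Adj x y → x ≠ v₀ := by
      rintro x y hne hxy rfl
      apply hne
      rcases aN y hxy with rfl | rfl
      exacts [hf1.symm, hf2.symm]
    rw [← hcol x (key x y hne hxy), ← hcol y (key y x hne.symm hxy.symm)]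
    exact hc _ _ hxy
  · intro m' hm'
    obtain ⟨p, q, hpq, hm⟩ := hlift m' hm'
    have hs := hsec p q hpq
    refine ⟨_, Function.update g w₀ p, isLift_of_return hc hm
      (Function.LeftInverse.injective hs.map)
      (fun w => by rw [hcol _ (hs.ne₀ w), hs.map]) fun n' hn' => ?_⟩
    obtain ⟨p₂, q₂, hpq₂, hn⟩ := hlift n' hn'
    refine ⟨_, hn, fun s => ?_⟩
    have hs₂ := hsec p₂ q₂ hpq₂
    have hp : Function.update g w₀ p w₀ = p := Function.update_self _ _ _
    have hp₂ : Function.update g w₀ p₂ w₀ = p₂ := Function.update_self _ _ _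
    have hoff : ∀ w, w ≠ w₀ → Function.update g w₀ p₂ w = Function.update g w₀ p w := fun w hw => by
      rw [Function.update_of_ne hw, Function.update_of_ne hw]
    have hsame : p₂ = p ∧ q₂ = q ∨ p₂ = q ∧ q₂ = p := by
      rcases hpq with ⟨rfl, rfl⟩ | ⟨rfl, rfl⟩ <;> rcases hpq₂ with ⟨rfl, rfl⟩ | ⟨rfl, rfl⟩ <;> simp
    generalize Function.update g w₀ p = ι at *
    generalize Function.update g w₀ p₂ = ι₂ at *
    have hn0 : n' w₀ ≠ w₀ := (hn'.adj w₀).ne'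
    rcases hsame with ⟨rfl, rfl⟩ | ⟨rfl, rfl⟩
    · have : ι₂ = ι := by
        funext w
        by_cases hw : w = w₀
        · rw [hw, hp, hp₂]
        · exact hoff w hw
      subst this
      left
      rw [hs.liftMate_map, hs.liftMate_map]
    -- The lifts differ at `v₀`. From the image of `w₀`, `n` leads to `v₀` and `m` on to the
    -- neighbour avoided by `ι`; the next round continues as `m' ∘ n'` does.
    · by_cases h1 : s = w₀
      · right
        subst h1
        rw [hp, hs₂.liftMate_neighbour, liftMate_self]
        refine ⟨fun ⟨w, hw⟩ => hs.ne₁ w hw, ?_⟩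
        have := hs₂.liftMate_map n' w₀
        rw [hp₂] at this
        rw [this, hoff _ hn0, hs.liftMate_map]
      -- Here `n` enters at the neighbour avoided by `ι`, `m` leads to `v₀`, and the next round
      -- crosses to the other neighbour before following `m'`.
      · by_cases h2 : n' s = w₀
        · right
          rw [← hoff s h1, hs₂.liftMate_map, h2, hp₂, hs.liftMate_neighbour]
          refine ⟨fun ⟨w, hw⟩ => hs.ne₀ w hw, ?_⟩
          rw [liftMate_self, ← hp, hs.liftMate_map]
        · left
          rw [← hoff s h1, hs₂.liftMate_map, hoff _ h2, hs.liftMate_map]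

lemma BicontractsTo.exists_lifts {W : Type v} {H : SimpleGraph W} {V : Type u}
    {G : SimpleGraph V} (h : BicontractsTo H G) {c : V → Bool} (hc : IsColouring G c) :
    ∃ c', IsColouring H c' ∧ Lifts G H c c' := by
  induction h with
  | iso e => exact exists_lifts_of_iso e hc
  | step h _ ih =>
    obtain ⟨c₁, hc₁, h₁⟩ := exists_lifts_of_isBicontraction h hc
    obtain ⟨c₂, hc₂, h₂⟩ := ih hc₁
    exact ⟨c₂, hc₂, h₁.trans h₂⟩

/-- All perfect matchings of `K` are extended by the same matching outside `K`, so `m ∘ n` restricts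
to `m' ∘ n'` on `K`. -/
lemma lifts_of_conformal {V : Type u} {G : SimpleGraph V} {K : G.Subgraph} (hK : Conformal K)
    {c : V → Bool} (hc : IsColouring G c) : Lifts G K.coe c (fun x => c x) := by
  classical
  obtain ⟨M, hM⟩ := hK
  obtain ⟨r, hr, -⟩ := exists_isMate hM
  let ext : (K.verts → K.verts) → V → V := fun m x =>
    if h : x ∈ K.verts then m ⟨x, h⟩ else r ⟨x, h⟩
  have ext_in : ∀ m (x : K.verts), ext m x = m x := fun m x => by simp [ext]
  have ext_out : ∀ m (x : ↥(K.vertsᶜ)), ext m x = r x := fun m x => by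
    have : (x : V) ∉ K.verts := x.2
    simp [ext, this]
  have hmate : ∀ m, IsMate K.coe m → IsMate G (ext m) := by
    intro m hm
    refine ⟨fun x => ?_, fun x => ?_⟩ <;> by_cases h : x ∈ K.verts
    · have := hm.adj ⟨x, h⟩
      rw [ext_in m ⟨x, h⟩]
      exact this.adj_sub
    · have := hr.adj ⟨x, h⟩
      rw [ext_out m ⟨x, h⟩]
      exact this
    · rw [ext_in m ⟨x, h⟩, ext_in, hm.invol]
    · rw [ext_out m ⟨x, h⟩, ext_out, hr.invol]
  exact fun m' hm' => ⟨ext m', Subtype.val, isLift_of_return hc (hmate m' hm')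
    Subtype.val_injective (fun _ => rfl) fun n' hn' =>
      ⟨ext n', hmate n' hn', fun s => Or.inl (by rw [ext_in, ext_in])⟩⟩

lemma IsMatchingMinor.exists_lifts {V : Type u} {W : Type v} {G : SimpleGraph V}
    {H : SimpleGraph W} (h : IsMatchingMinor H G) {c : V → Bool} (hc : IsColouring G c) :
    ∃ c', IsColouring H c' ∧ Lifts G H c c' := by
  obtain ⟨K, hK, h⟩ := h
  obtain ⟨c', hc', h'⟩ := h.exists_lifts (c := fun x => c x)
    (fun v w hvw => hc _ _ (SimpleGraph.Subgraph.Adj.adj_sub hvw))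
  exact ⟨c', hc', (lifts_of_conformal hK hc).trans h'⟩

/-! ### Branches of trees -/

/-- The vertices that are joined to `t` after deleting the edge `tt'`. -/
def branch {τ : Type u} (T : SimpleGraph τ) (t t' : τ) : Set τ :=
  {x | (T.deleteEdges {s(t, t')}).Reachable t x}

section Branch

variable {τ : Type u} {T : SimpleGraph τ}

lemma reachable_subset {u : τ} {S : Set τ} (hu : u ∈ S)
    (hS : ∀ x ∈ S, ∀ y, T.Adj x y → y ∈ S) {x : τ} (hx : T.Reachable u x) : x ∈ S := by
  rw [SimpleGraph.reachable_iff_reflTransGen] at hx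
  induction hx with
  | refl => exact hu
  | tail _ h ih => exact hS _ ih _ h

lemma self_mem_branch (t t' : τ) : t ∈ branch T t t' :=
  SimpleGraph.Reachable.refl _

lemma mem_branch_of_adj {t t' x y : τ} (hx : x ∈ branch T t t') (hxy : T.Adj x y)
    (hne : s(x, y) ≠ s(t, t')) : y ∈ branch T t t' :=
  SimpleGraph.Reachable.trans hx
    (SimpleGraph.deleteEdges_adj.2 ⟨hxy, hne⟩).reachable

lemma branch_subset {t t' : τ} {S : Set τ} (ht : t ∈ S)
    (hS : ∀ x ∈ S, ∀ y, T.Adj x y → s(x, y) ≠ s(t, t') → y ∈ S) : branch T t t' ⊆ S :=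
  fun _ hx => reachable_subset (T := T.deleteEdges {s(t, t')}) ht
    (fun x hx y hxy => hS x hx y (SimpleGraph.deleteEdges_adj.1 hxy).1
      (by simpa using (SimpleGraph.deleteEdges_adj.1 hxy).2)) hx

lemma disjoint_branch (hT : T.IsAcyclic) {t t' : τ} (h : T.Adj t t') :
    Disjoint (branch T t t') (branch T t' t) := by
  rw [Set.disjoint_left]
  intro x hx hx'
  have hb := SimpleGraph.isAcyclic_iff_forall_adj_isBridge.1 hT h
  rw [SimpleGraph.isBridge_iff] at hb
  refine hb (SimpleGraph.Reachable.trans hx (SimpleGraph.Reachable.symm ?_))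
  rw [Sym2.eq_swap]
  exact hx'

lemma notMem_branch (hT : T.IsAcyclic) {t t' : τ} (h : T.Adj t t') : t' ∉ branch T t t' :=
  fun h' => Set.disjoint_left.1 (disjoint_branch hT h) h' (self_mem_branch _ _)

lemma branch_union_branch (hT : T.Connected) (t t' : τ) :
    branch T t t' ∪ branch T t' t = Set.univ := by
  refine Set.eq_univ_of_forall fun x => ?_
  refine reachable_subset (T := T) (Or.inl (self_mem_branch t t')) ?_ (hT.preconnected t x)
  rintro y hy z hyz
  by_cases hne : s(y, z) = s(t, t')
  · rcases Sym2.eq_iff.1 hne with ⟨-, rfl⟩ | ⟨-, rfl⟩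
    · exact Or.inr (self_mem_branch _ _)
    · exact Or.inl (self_mem_branch _ _)
  · rcases hy with hy | hy
    · exact Or.inl (mem_branch_of_adj hy hyz hne)
    · exact Or.inr (mem_branch_of_adj hy hyz (by rwa [Sym2.eq_swap (a := t')]))

lemma branch_compl (hT : T.IsTree) {t t' : τ} (h : T.Adj t t') :
    (branch T t t')ᶜ = branch T t' t :=
  IsCompl.compl_eq ⟨disjoint_branch hT.isAcyclic h,
    codisjoint_iff.2 (branch_union_branch hT.connected t t')⟩

lemma branch_subset_branch (hT : T.IsAcyclic) {t t' a : τ} (hta : T.Adj t a) (ha : a ≠ t') :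
    branch T a t ⊆ branch T t t' := by
  -- Membership in both branches is propagated together: the first keeps the walk away from `t`,
  -- hence off the edge `tt'`.
  have hsub : branch T a t ⊆ branch T a t ∩ branch T t t' := by
    refine branch_subset ⟨self_mem_branch _ _, ?_⟩ ?_
    · refine mem_branch_of_adj (self_mem_branch _ _) hta fun h => ?_
      rcases Sym2.eq_iff.1 h with ⟨-, h⟩ | ⟨h, h'⟩
      · exact ha h
      · exact hta.ne h'.symm
    · rintro x ⟨hx, hx'⟩ y hxy hne
      have hy := mem_branch_of_adj hx hxy hne
      have ht := notMem_branch hT hta.symm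
      refine ⟨hy, mem_branch_of_adj hx' hxy fun h => ?_⟩
      rcases Sym2.eq_iff.1 h with ⟨rfl, -⟩ | ⟨-, rfl⟩
      · exact ht hx
      · exact ht hy
  exact hsub.trans Set.inter_subset_right

lemma branch_eq (hT : T.IsAcyclic) (t t' : τ) :
    branch T t t' = {x | x = t ∨ ∃ a, T.Adj t a ∧ a ≠ t' ∧ x ∈ branch T a t} := by
  refine subset_antisymm (branch_subset (Or.inl rfl) ?_) ?_
  · rintro x (rfl | ⟨a, ha, hat, hx⟩) y hxy hne
    · refine Or.inr ⟨y, hxy, ?_, self_mem_branch _ _⟩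
      rintro rfl
      exact hne rfl
    · by_cases h : s(x, y) = s(a, t)
      · rcases Sym2.eq_iff.1 h with ⟨-, h⟩ | ⟨-, h⟩
        · exact Or.inl h
        · exact Or.inr ⟨a, ha, hat, h ▸ self_mem_branch _ _⟩
      · exact Or.inr ⟨a, ha, hat, mem_branch_of_adj hx hxy h⟩
  · rintro x (rfl | ⟨a, ha, hat, hx⟩)
    · exact self_mem_branch _ _
    · exact branch_subset_branch hT ha hat hx

lemma disjoint_branch_branch (hT : T.IsAcyclic) {t a b : τ} (ha : T.Adj t a) (hb : T.Adj t b)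
    (hab : a ≠ b) : Disjoint (branch T a t) (branch T b t) :=
  (disjoint_branch hT hb).mono_left (branch_subset_branch hT ha hab)

end Branch

/-! ### Sets that decompose into singletons -/

/-- `X` can be assembled from singletons by disjoint unions, where all sets that occur have the
property `P`. -/
inductive Good {V : Type u} (P : Set V → Prop) : Set V → Prop
  | single (v : V) (h : P {v}) : Good P {v}
  | union {X Y : Set V} (hX : Good P X) (hY : Good P Y) (hd : Disjoint X Y) (h : P (X ∪ Y)) :
      Good P (X ∪ Y)

lemma Good.union_eq {V : Type u} {P : Set V → Prop} {X Y Z : Set V} (hX : Good P X)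
    (hY : Good P Y) (hd : Disjoint X Y) (hZ : X ∪ Y = Z) (h : P Z) : Good P Z := by
  subst hZ
  exact hX.union hY hd h

lemma Decomposition.shore_eq {V : Type u} (D : Decomposition V) (t t' : Fin D.n) :
    D.shore t t' = {x | (D.δ.symm x : Fin D.n) ∈ branch D.T t t'} := rfl

lemma Decomposition.shore_eq_singleton {V : Type u} (D : Decomposition V) {t t' : Fin D.n}
    (h : D.T.Adj t t') (ht : IsLeaf D.T t) : D.shore t t' = {D.δ ⟨t, ht⟩} := by
  have hN : ∀ a, D.T.Adj t a → a = t' := fun a ha =>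
    (Set.ncard_le_one_iff (Set.toFinite _)).1 ht ha h
  have hb : branch D.T t t' = {t} := by
    rw [branch_eq D.isTree.isAcyclic]
    ext x
    simp only [Set.mem_ofPred_eq, Set.mem_singleton_iff, or_iff_left_iff_imp]
    rintro ⟨a, ha, hat, -⟩
    exact absurd (hN a ha) hat
  rw [D.shore_eq, hb]
  ext x
  simp only [Set.mem_ofPred_eq, Set.mem_singleton_iff]
  rw [← Equiv.symm_apply_eq, Subtype.ext_iff]

/-- Induction on the size of the branch: at an inner vertex `t` the branch consists of `t`, which
carries no label, and the disjoint branches at the two neighbours other than `t'`. -/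
lemma Decomposition.good_shore {V : Type u} {P : Set V → Prop} (D : Decomposition V)
    (hP : ∀ t t', D.T.Adj t t' → P (D.shore t t')) (t t' : Fin D.n) (h : D.T.Adj t t') :
    Good P (D.shore t t') := by
  have hT := D.isTree.isAcyclic
  induction hk : (branch D.T t t').ncard using Nat.strong_induction_on generalizing t t' with
  | _ k ih =>
    subst hk
    by_cases ht : IsLeaf D.T t
    · have := hP t t' h
      rw [D.shore_eq_singleton h ht] at this ⊢
      exact Good.single _ this
    obtain ⟨a, b, hab, hat, hbt, hN⟩ : ∃ a b, a ≠ b ∧ a ≠ t' ∧ b ≠ t' ∧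
        D.T.neighborSet t = {t', a, b} := by
      obtain ⟨x, y, z, hxy, hxz, hyz, hN⟩ := Set.ncard_eq_three.1 (D.cubic t ht)
      have : t' ∈ ({x, y, z} : Set _) := hN ▸ h
      rcases this with rfl | rfl | rfl
      · exact ⟨y, z, hyz, hxy.symm, hxz.symm, hN⟩
      · exact ⟨x, z, hxz, hxy, hyz.symm, by rw [hN, Set.insert_comm]⟩
      · exact ⟨x, y, hxy, hxz, hyz, by rw [hN, Set.pair_comm y, Set.insert_comm]⟩
    have hadj : ∀ x, D.T.Adj t x ↔ x = t' ∨ x = a ∨ x = b := fun x => by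
      have : D.T.Adj t x ↔ x ∈ D.T.neighborSet t := Iff.rfl
      rw [this, hN]
      rfl
    have ha : D.T.Adj t a := (hadj a).2 (by simp)
    have hb : D.T.Adj t b := (hadj b).2 (by simp)
    have hlt : ∀ x, D.T.Adj t x → x ≠ t' → (branch D.T x t).ncard < (branch D.T t t').ncard := by
      intro x hx hxt
      refine Set.ncard_lt_ncard ⟨branch_subset_branch hT hx hxt, fun hsub => ?_⟩
      exact notMem_branch hT hx.symm (hsub (self_mem_branch _ _))
    refine (ih _ (hlt a ha hat) a t ha.symm rfl).union_eq (ih _ (hlt b hb hbt) b t hb.symm rfl)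
      ?_ ?_ (hP t t' h)
    · rw [Set.disjoint_left]
      exact fun x hx hx' =>
        Set.disjoint_left.1 (disjoint_branch_branch hT ha hb hab) hx hx'
    · ext x
      have hx : (D.δ.symm x : Fin D.n) ≠ t := fun hx => ht (hx ▸ (D.δ.symm x).2)
      simp only [D.shore_eq, branch_eq hT t t', Set.mem_union, Set.mem_ofPred_eq, hx, false_or]
      constructor
      · rintro (hx | hx)
        exacts [⟨a, ha, hat, hx⟩, ⟨b, hb, hbt, hx⟩]
      · rintro ⟨d, hd, hdt, hx⟩
        rcases (hadj d).1 hd with rfl | rfl | rfl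
        exacts [absurd rfl hdt, Or.inl hx, Or.inr hx]

lemma Decomposition.shore_compl {V : Type u} (D : Decomposition V) {t t' : Fin D.n}
    (h : D.T.Adj t t') : (D.shore t t')ᶜ = D.shore t' t := by
  rw [D.shore_eq, D.shore_eq, ← branch_compl D.isTree h]
  rfl

/-- The edge at the leaf of `v` has shores `{v}` and its complement. -/
lemma Decomposition.good_compl_singleton {V : Type u} [Nontrivial V] {P : Set V → Prop}
    (D : Decomposition V) (hP : ∀ t t', D.T.Adj t t' → P (D.shore t t')) (v : V) :
    P {v} ∧ Good P {v}ᶜ := by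
  obtain ⟨w, hw⟩ := exists_ne v
  have hne : (D.δ.symm v : Fin D.n) ≠ D.δ.symm w := fun h =>
    hw (D.δ.symm.injective (Subtype.ext h)).symm
  have : Nontrivial (Fin D.n) := ⟨_, _, hne⟩
  obtain ⟨t', ht'⟩ := D.isTree.connected.preconnected.exists_adj_of_nontrivial (D.δ.symm v : Fin D.n)
  have hs : D.shore (D.δ.symm v) t' = {v} := by
    rw [D.shore_eq_singleton ht' (D.δ.symm v).2]
    simp
  refine ⟨hs ▸ hP _ _ ht', ?_⟩
  rw [← hs, D.shore_compl ht']
  exact D.good_shore hP _ _ ht'.symm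

/-- Good sets pull back along maps whose fibres are good. -/
lemma Good.preimage {V : Type u} {W : Type v} {P : Set V → Prop} {Q : Set W → Prop} {φ : W → V}
    (hPQ : ∀ X, P X → Q (φ ⁻¹' X)) (hφ : ∀ v, P {v} → φ ⁻¹' {v} = ∅ ∨ Good Q (φ ⁻¹' {v}))
    {X : Set V} (hX : Good P X) : φ ⁻¹' X = ∅ ∨ Good Q (φ ⁻¹' X) := by
  induction hX with
  | single v h => exact hφ v h
  | union _ _ hd h ihX ihY =>
    rw [Set.preimage_union]
    rcases ihX with hX | hX
    · rwa [hX, Set.empty_union]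
    rcases ihY with hY | hY
    · exact Or.inr (by rwa [hY, Set.union_empty])
    · exact Or.inr (hX.union hY (hd.preimage φ) (by rw [← Set.preimage_union]; exact hPQ _ h))

/-! ### Decompositions from laminar families -/

/-- A laminar family of subsets of `X` that contains `X` and the singletons, in which every other
member has exactly two maximal proper subsets, and these partition it. -/
structure IsFamily {W : Type u} (P : Set W → Prop) (F : Set (Set W)) (X : Set W) : Prop where
  top_mem : X ∈ F
  subset : ∀ Y ∈ F, Y ⊆ X
  prop : ∀ Y ∈ F, P Y
  nonempty : ∀ Y ∈ F, Y.Nonempty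
  singleton_mem : ∀ w ∈ X, {w} ∈ F
  split : ∀ Y ∈ F, (∃ w, Y = {w}) ∨ ∃ Y₁ ∈ F, ∃ Y₂ ∈ F, Disjoint Y₁ Y₂ ∧ Y = Y₁ ∪ Y₂ ∧
    ∀ Z ∈ F, Z ⊆ Y → Z = Y ∨ Z ⊆ Y₁ ∨ Z ⊆ Y₂
  laminar : ∀ Y ∈ F, ∀ Z ∈ F, Y ⊆ Z ∨ Z ⊆ Y ∨ Disjoint Y Z

lemma IsFamily.single {W : Type u} {P : Set W → Prop} {w : W} (h : P {w}) :
    IsFamily P {{w}} {w} where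
  top_mem := rfl
  subset := by rintro _ rfl; exact subset_rfl
  prop := by rintro _ rfl; exact h
  nonempty := by rintro _ rfl; exact Set.singleton_nonempty w
  singleton_mem := by rintro _ rfl; rfl
  split := by rintro _ rfl; exact Or.inl ⟨w, rfl⟩
  laminar := by rintro _ rfl _ rfl; exact Or.inl subset_rfl

lemma IsFamily.union {W : Type u} {P : Set W → Prop} {F G : Set (Set W)} {X Y : Set W}
    (hF : IsFamily P F X) (hG : IsFamily P G Y) (hd : Disjoint X Y) (h : P (X ∪ Y)) :
    IsFamily P (insert (X ∪ Y) (F ∪ G)) (X ∪ Y) := by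
  have hsub : ∀ Z ∈ insert (X ∪ Y) (F ∪ G), Z ⊆ X ∪ Y := by
    rintro Z (rfl | hZ | hZ)
    · exact subset_rfl
    · exact (hF.subset Z hZ).trans Set.subset_union_left
    · exact (hG.subset Z hZ).trans Set.subset_union_right
  have hFG : ∀ A ∈ F, ∀ B ∈ G, Disjoint A B := fun A hA B hB =>
    hd.mono (hF.subset A hA) (hG.subset B hB)
  -- Stated for arbitrary `F` and `G` so that it serves both families by symmetry.
  have hsplit : ∀ {F G : Set (Set W)} {X Y : Set W}, IsFamily P F X → IsFamily P G Y →
      Disjoint X Y → ∀ A ∈ F, (∃ w, A = {w}) ∨ ∃ A₁ ∈ insert (X ∪ Y) (F ∪ G),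
        ∃ A₂ ∈ insert (X ∪ Y) (F ∪ G), Disjoint A₁ A₂ ∧ A = A₁ ∪ A₂ ∧
        ∀ Z ∈ insert (X ∪ Y) (F ∪ G), Z ⊆ A → Z = A ∨ Z ⊆ A₁ ∨ Z ⊆ A₂ := by
    intro F G X Y hF hG hd A hA
    rcases hF.split A hA with hw | ⟨A₁, h₁, A₂, h₂, h12, hU, hm⟩
    · exact Or.inl hw
    refine Or.inr ⟨A₁, by simp [h₁], A₂, by simp [h₂], h12, hU, ?_⟩
    rintro Z (rfl | hZ | hZ) hZA
    · exact Or.inl (subset_antisymm hZA ((hF.subset A hA).trans Set.subset_union_left))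
    · exact hm Z hZ hZA
    -- Members are nonempty, so a member of `G` cannot lie inside a subset of `X`.
    · exfalso
      obtain ⟨z, hz⟩ := hG.nonempty Z hZ
      exact Set.disjoint_left.1 hd (hF.subset A hA (hZA hz)) (hG.subset Z hZ hz)
  refine ⟨Set.mem_insert _ _, hsub, ?_, ?_, ?_, ?_, ?_⟩
  · rintro Z (rfl | hZ | hZ)
    exacts [h, hF.prop Z hZ, hG.prop Z hZ]
  · rintro Z (rfl | hZ | hZ)
    exacts [(hF.nonempty X hF.top_mem).inl, hF.nonempty Z hZ, hG.nonempty Z hZ]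
  · rintro w (hw | hw)
    exacts [Or.inr (Or.inl (hF.singleton_mem w hw)), Or.inr (Or.inr (hG.singleton_mem w hw))]
  · rintro Z (rfl | hZ | hZ)
    · refine Or.inr ⟨X, by simp [hF.top_mem], Y, by simp [hG.top_mem], hd, rfl, ?_⟩
      rintro Z (rfl | hZ | hZ) -
      exacts [Or.inl rfl, Or.inr (Or.inl (hF.subset Z hZ)), Or.inr (Or.inr (hG.subset Z hZ))]
    · exact hsplit hF hG hd Z hZ
    · have := hsplit hG hF hd.symm Z hZ
      rwa [Set.union_comm Y X, Set.union_comm G F] at this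
  · rintro A hA B hB
    rcases hA with rfl | hA | hA
    · exact Or.inr (Or.inl (hsub B hB))
    all_goals rcases hB with rfl | hB | hB
    · exact Or.inl (hsub A (by simp [hA]))
    · exact hF.laminar A hA B hB
    · exact Or.inr (Or.inr (hFG A hA B hB))
    · exact Or.inl (hsub A (by simp [hA]))
    · exact Or.inr (Or.inr (hFG B hB A hA).symm)
    · exact hG.laminar A hA B hB

lemma Good.exists_family {W : Type u} {P : Set W → Prop} {X : Set W} (h : Good P X) :
    ∃ F, IsFamily P F X := by
  induction h with
  | single w h => exact ⟨_, IsFamily.single h⟩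
  | union _ _ hd h ihX ihY =>
    obtain ⟨F, hF⟩ := ihX
    obtain ⟨G, hG⟩ := ihY
    exact ⟨_, hF.union hG hd h⟩

/-- A cubic tree on an arbitrary finite type, with its leaves labelled by `W`, yields a
decomposition. -/
lemma exists_decomposition_of_tree {W : Type v} {τ : Type u} [Finite τ] (T : SimpleGraph τ)
    (hT : T.IsTree)
    (cubic : ∀ t, ¬ (T.neighborSet t).ncard ≤ 1 → (T.neighborSet t).ncard = 3)
    (l : W → τ) (hl : Function.Injective l)
    (hleaf : ∀ t, (T.neighborSet t).ncard ≤ 1 ↔ t ∈ Set.range l) :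
    ∃ D : Decomposition W, ∀ i j, D.T.Adj i j →
      ∃ a b, T.Adj a b ∧ D.shore i j = l ⁻¹' (branch T a b) := by
  obtain ⟨n, ⟨e⟩⟩ := Finite.exists_equiv_fin τ
  let T' : SimpleGraph (Fin n) := T.comap e.symm
  let φ : T' ≃g T := ⟨e.symm, Iff.rfl⟩
  have hN : ∀ i, (T'.neighborSet i).ncard = (T.neighborSet (e.symm i)).ncard := by
    intro i
    rw [← Set.ncard_image_of_injective _ e.symm.injective]
    congr 1
    ext x
    constructor
    · rintro ⟨j, hj, rfl⟩
      exact hj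
    · intro hx
      refine ⟨e x, ?_, by simp⟩
      change T.Adj (e.symm i) (e.symm (e x))
      simpa using hx
  have hleaf' : ∀ i, IsLeaf T' i ↔ e.symm i ∈ Set.range l := fun i => by
    rw [IsLeaf, hN, hleaf]
  let g : W → {i : Fin n // IsLeaf T' i} := fun w => ⟨e (l w), by rw [hleaf']; simp⟩
  have hg : Function.Bijective g := by
    constructor
    · intro w w' h
      exact hl (e.injective (Subtype.ext_iff.1 h))
    · rintro ⟨i, hi⟩
      obtain ⟨w, hw⟩ := (hleaf' i).1 hi
      exact ⟨w, Subtype.ext (by simp [g, hw])⟩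
  let D : Decomposition W :=
    { n := n
      T := T'
      isTree := φ.isTree_iff.2 hT
      cubic := fun i hi => by
        rw [hN]
        exact cubic _ (by rwa [IsLeaf, hN] at hi)
      δ := (Equiv.ofBijective g hg).symm }
  refine ⟨D, fun i j hij => ⟨e.symm i, e.symm j, hij, ?_⟩⟩
  let ψ : T'.deleteEdges {s(i, j)} ≃g T.deleteEdges {s(e.symm i, e.symm j)} :=
    ⟨e.symm, by
      intro a b
      simp only [SimpleGraph.deleteEdges_adj, Set.mem_singleton_iff, Sym2.eq_iff,
        e.symm.injective.eq_iff]
      exact Iff.rfl⟩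
  ext w
  have h1 : w ∈ D.shore i j ↔ (T'.deleteEdges {s(i, j)}).Reachable i (e (l w)) := Iff.rfl
  rw [h1, ← ψ.reachable_iff]
  change (T.deleteEdges {s(e.symm i, e.symm j)}).Reachable (e.symm i) (e.symm (e (l w))) ↔ _
  rw [e.symm_apply_apply]
  rfl

lemma eq_right_of_covBy {α : Type u} [PartialOrder α] {a b c : α} (h : a ⋖ b) (hac : a < c)
    (hcb : c ≤ b) : c = b :=
  (h.eq_or_eq hac.le hcb).resolve_left hac.ne'

lemma eq_left_of_covBy {α : Type u} [PartialOrder α] {a b c : α} (h : a ⋖ b) (hac : a ≤ c)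
    (hcb : c < b) : c = a :=
  (h.eq_or_eq hac hcb.le).resolve_right hcb.ne

/-! ### Hasse diagrams of finite forest orders -/

section Hasse

variable {τ : Type u} [PartialOrder τ] [Finite τ]

/-- As the elements above a given one form a chain, upper covers are unique; hence `s(x, y)` is the
only edge leaving the down-set of `x`. -/
lemma branch_hasse (hlam : ∀ x y z : τ, x ≤ y → x ≤ z → y ≤ z ∨ z ≤ y) {x y : τ} (hxy : x ⋖ y) :
    branch (SimpleGraph.hasse τ) x y = Set.Iic x := by
  refine subset_antisymm (branch_subset le_rfl ?_) ?_
  · rintro a ha b hab hne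
    rcases SimpleGraph.hasse_adj.1 hab with h | h
    · rcases eq_or_lt_of_le (show a ≤ x from ha) with rfl | hlt
      · exfalso
        apply hne
        have : b = y := by
          rcases hlam a b y h.le hxy.le with h' | h'
          · exact eq_right_of_covBy hxy h.lt h'
          · exact (eq_right_of_covBy h hxy.lt h').symm
        rw [this]
      · rcases hlam a b x h.le hlt.le with h' | h'
        · exact h'
        · exact (eq_right_of_covBy h hlt h').ge
    · exact h.le.trans ha
  · intro z hz
    induction z using (wellFounded_gt (α := τ)).induction with
    | _ z ih =>
      rcases eq_or_lt_of_le (show z ≤ x from hz) with rfl | hlt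
      · exact self_mem_branch _ _
      obtain ⟨z', h1, h2⟩ := exists_covBy_le_of_lt hlt
      refine mem_branch_of_adj (ih z' h1.lt h2) (SimpleGraph.hasse_adj.2 (Or.inr h1)) ?_
      intro h
      rcases Sym2.eq_iff.1 h with ⟨-, h⟩ | ⟨-, h⟩
      · exact (hlt.trans hxy.lt).ne h
      · exact hlt.ne h

lemma isTree_hasse [OrderTop τ] (hlam : ∀ x y z : τ, x ≤ y → x ≤ z → y ≤ z ∨ z ≤ y) :
    (SimpleGraph.hasse τ).IsTree := by
  have htop : ∀ z : τ, (SimpleGraph.hasse τ).Reachable z ⊤ := by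
    intro z
    induction z using (wellFounded_gt (α := τ)).induction with
    | _ z ih =>
      rcases eq_or_lt_of_le (le_top (a := z)) with rfl | hlt
      · rfl
      obtain ⟨z', h1, -⟩ := exists_covBy_le_of_lt hlt
      exact (SimpleGraph.Adj.reachable (SimpleGraph.hasse_adj.2 (Or.inl h1))).trans
        (ih z' h1.lt)
  refine ⟨⟨fun a b => (htop a).trans (htop b).symm⟩, ?_⟩
  have key : ∀ x y : τ, x ⋖ y → (SimpleGraph.hasse τ).IsBridge s(x, y) := fun x y h => by
    rw [SimpleGraph.isBridge_iff]
    intro hr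
    have : y ∈ branch (SimpleGraph.hasse τ) x y := hr
    rw [branch_hasse hlam h] at this
    exact h.lt.not_ge this
  rw [SimpleGraph.isAcyclic_iff_forall_adj_isBridge]
  intro x y hxy
  rcases SimpleGraph.hasse_adj.1 hxy with h | h
  · exact key x y h
  · rw [Sym2.eq_swap]
    exact key y x h

end Hasse

/-- A family on all of `W` would give a root of degree two. Working in `{b}ᶜ` and adding `Set.univ`
on top makes the root a leaf, labelled `b`. Other members have one upper cover, and two lower covers
unless they are singletons. -/
lemma IsFamily.exists_decomposition {W : Type u} [Finite W] {P : Set W → Prop}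
    {F : Set (Set W)} {b : W} (hF : IsFamily P F {b}ᶜ) :
    ∃ D : Decomposition W, ∀ i j, D.T.Adj i j → P (D.shore i j) ∨ P (D.shore i j)ᶜ := by
  classical
  let τ := {Y : Set W // Y ∈ F ∨ Y = Set.univ}
  let _ : OrderTop τ := { top := ⟨Set.univ, Or.inr rfl⟩, le_top := fun Y => Set.subset_univ Y.1 }
  have hFb : ∀ Y ∈ F, b ∉ Y := fun Y hY hb => hF.subset Y hY hb rfl
  have hFne : ∀ Y ∈ F, Y ≠ Set.univ := fun Y hY h => hFb Y hY (h ▸ Set.mem_univ b)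
  have hle : ∀ x y : τ, x ≤ y ↔ x.1 ⊆ y.1 := fun x y => Iff.rfl
  have hne : ∀ x : τ, x.1.Nonempty := by
    rintro ⟨Y, hY | rfl⟩
    · exact hF.nonempty Y hY
    · exact ⟨b, Set.mem_univ b⟩
  have hlam : ∀ x y z : τ, x ≤ y → x ≤ z → y ≤ z ∨ z ≤ y := by
    rintro x ⟨Y, hY | rfl⟩ ⟨Z, hZ | rfl⟩ hxy hxz
    · rcases hF.laminar Y hY Z hZ with h | h | h
      · exact Or.inl h
      · exact Or.inr h
      · obtain ⟨w, hw⟩ := hne x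
        exact absurd (hxz hw) (Set.disjoint_left.1 h (hxy hw))
    · exact Or.inl (Set.subset_univ _)
    · exact Or.inr (Set.subset_univ _)
    · exact Or.inl (Set.subset_univ _)
  have hadj : ∀ x y : τ, y ∈ (SimpleGraph.hasse τ).neighborSet x ↔ x ⋖ y ∨ y ⋖ x :=
    fun _ _ => SimpleGraph.hasse_adj
  -- every member of the family has a unique upper cover
  have hup : ∀ x : τ, x.1 ∈ F → ∃ p, ∀ y, x ⋖ y ↔ y = p := by
    intro x hx
    have hlt : x < ⊤ := lt_top_iff_ne_top.2 fun h => hFne _ hx (Subtype.ext_iff.1 h)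
    obtain ⟨p, hp, -⟩ := exists_covBy_le_of_lt hlt
    refine ⟨p, fun y => ⟨fun hy => ?_, fun h => h ▸ hp⟩⟩
    rcases hlam x y p hy.le hp.le with h | h
    · exact eq_right_of_covBy hp hy.lt h
    · exact (eq_right_of_covBy hy hp.lt h).symm
  let l : W → τ := fun w => if h : w = b then ⊤ else ⟨{w}, Or.inl (hF.singleton_mem w h)⟩
  have lb : l b = ⊤ := by simp [l]
  have ls : ∀ w, w ≠ b → (l w).1 = {w} := fun w hw => by simp [l, hw]
  have hcard_top : ((SimpleGraph.hasse τ).neighborSet ⊤).ncard ≤ 1 := by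
    have : (SimpleGraph.hasse τ).neighborSet ⊤ ⊆ {⟨{b}ᶜ, Or.inl hF.top_mem⟩} := by
      intro y hy
      rcases (hadj _ _).1 hy with h | h
      · exact absurd h.lt not_top_lt
      have hyF : y.1 ∈ F := y.2.resolve_right fun h' => h.lt.ne (Subtype.ext h')
      have h1 : y ≤ (⟨{b}ᶜ, Or.inl hF.top_mem⟩ : τ) := hF.subset _ hyF
      refine (eq_left_of_covBy h h1 (lt_top_iff_ne_top.2 fun h' => ?_)).symm
      exact hFne _ hF.top_mem (Subtype.ext_iff.1 h')
    exact (Set.ncard_le_ncard this).trans (Set.ncard_singleton _).le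
  have hcard_single : ∀ w, w ≠ b → ((SimpleGraph.hasse τ).neighborSet (l w)).ncard ≤ 1 := by
    intro w hw
    obtain ⟨p, hp⟩ := hup (l w) (by rw [ls w hw]; exact hF.singleton_mem w hw)
    have : (SimpleGraph.hasse τ).neighborSet (l w) ⊆ {p} := by
      intro y hy
      rcases (hadj _ _).1 hy with h | h
      · exact (hp y).1 h
      · exfalso
        have h1 : y.1 ⊆ {w} := ls w hw ▸ h.le
        refine h.lt.ne (Subtype.ext ?_)
        rw [ls w hw]
        exact ((hne y).subset_singleton_iff).1 h1
    exact (Set.ncard_le_ncard this).trans (Set.ncard_singleton _).le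
  have hcard : ∀ x : τ, x ∉ Set.range l → ((SimpleGraph.hasse τ).neighborSet x).ncard = 3 := by
    intro x hx
    have hxF : x.1 ∈ F := x.2.resolve_right fun h => hx ⟨b, by rw [lb]; exact Subtype.ext h.symm⟩
    obtain ⟨p, hp⟩ := hup x hxF
    rcases hF.split x.1 hxF with ⟨w, hw⟩ | ⟨Y₁, h₁, Y₂, h₂, hd, hU, hm⟩
    · have hwb : w ≠ b := by
        rintro rfl
        exact hFb _ hxF (by rw [hw]; rfl)
      exact absurd ⟨w, Subtype.ext (by rw [ls w hwb, hw])⟩ hx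
    have hcov : ∀ (A B : Set W) (hA : A ∈ F) (_ : B ∈ F), Disjoint A B → x.1 = A ∪ B →
        (∀ Z ∈ F, Z ⊆ x.1 → Z = x.1 ∨ Z ⊆ A ∨ Z ⊆ B) → (⟨A, Or.inl hA⟩ : τ) ⋖ x := by
      intro A B hA hB hd hU hm
      obtain ⟨a, ha⟩ := hF.nonempty A hA
      obtain ⟨b', hb'⟩ := hF.nonempty B hB
      refine ⟨lt_of_le_of_ne ?_ ?_, fun z hz hz' => ?_⟩
      · rw [hle, hU]; exact Set.subset_union_left
      · intro h
        have : A = x.1 := Subtype.ext_iff.1 h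
        exact Set.disjoint_left.1 hd (by rw [this, hU]; exact Or.inr hb') hb'
      · have hzF : z.1 ∈ F := z.2.resolve_right fun h =>
          hFne _ hxF (Set.univ_subset_iff.1 (h.ge.trans hz'.le))
        rcases hm z.1 hzF hz'.le with h | h | h
        · exact hz'.ne (Subtype.ext h)
        · exact hz.not_ge h
        · exact Set.disjoint_left.1 hd ha (h (hz.le ha))
    have c₁ := hcov Y₁ Y₂ h₁ h₂ hd hU hm
    have c₂ := hcov Y₂ Y₁ h₂ h₁ hd.symm (by rw [hU, Set.union_comm])
      (fun Z hZ hZx => (hm Z hZ hZx).imp id Or.symm)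
    have hN : (SimpleGraph.hasse τ).neighborSet x = {p, ⟨Y₁, Or.inl h₁⟩, ⟨Y₂, Or.inl h₂⟩} := by
      ext y
      rw [hadj, hp]
      simp only [Set.mem_insert_iff, Set.mem_singleton_iff]
      refine or_congr_right ⟨fun hy => ?_, ?_⟩
      · have hyF : y.1 ∈ F := y.2.resolve_right fun h =>
          hFne _ hxF (Set.univ_subset_iff.1 (h.ge.trans hy.le))
        rcases hm y.1 hyF hy.le with h | h | h
        · exact absurd (Subtype.ext h) hy.lt.ne
        · exact Or.inl (eq_left_of_covBy hy (c := ⟨Y₁, Or.inl h₁⟩) h c₁.lt).symm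
        · exact Or.inr (eq_left_of_covBy hy (c := ⟨Y₂, Or.inl h₂⟩) h c₂.lt).symm
      · rintro (rfl | rfl)
        exacts [c₁, c₂]
    have hxp : x < p := ((hp p).2 rfl).lt
    rw [Set.ncard_eq_three]
    refine ⟨_, _, _, (c₁.lt.trans hxp).ne', (c₂.lt.trans hxp).ne', ?_, hN⟩
    intro h
    obtain ⟨a, ha⟩ := hF.nonempty Y₁ h₁
    have : Y₁ = Y₂ := Subtype.ext_iff.1 h
    exact Set.disjoint_left.1 hd ha (this ▸ ha)
  have hleaf : ∀ x : τ, ((SimpleGraph.hasse τ).neighborSet x).ncard ≤ 1 ↔ x ∈ Set.range l := by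
    intro x
    constructor
    · intro h
      by_contra hx
      have := hcard x hx
      omega
    · rintro ⟨w, rfl⟩
      by_cases hw : w = b
      · rw [hw, lb]; exact hcard_top
      · exact hcard_single w hw
  have hl : Function.Injective l := by
    have htop : ∀ w, w ≠ b → l w ≠ ⊤ := fun w hw h => by
      have h' : (l w).1 = Set.univ := Subtype.ext_iff.1 h
      rw [ls w hw] at h'
      exact hw (h' ▸ Set.mem_univ b : b ∈ ({w} : Set W)).symm
    intro w w' h
    by_cases hw : w = b <;> by_cases hw' : w' = b
    · rw [hw, hw']
    · rw [hw, lb] at h; exact absurd h.symm (htop w' hw')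
    · rw [hw', lb] at h; exact absurd h (htop w hw)
    · have := congrArg Subtype.val h
      rw [ls w hw, ls w' hw'] at this
      exact Set.singleton_injective this
  have hT : (SimpleGraph.hasse τ).IsTree := isTree_hasse hlam
  obtain ⟨D, hD⟩ := exists_decomposition_of_tree (SimpleGraph.hasse τ) hT
    (fun x hx => hcard x fun h => hx ((hleaf x).2 h)) l hl hleaf
  have hpre : ∀ x y : τ, x ⋖ y → P (l ⁻¹' branch (SimpleGraph.hasse τ) x y) := by
    intro x y hxy
    have hxF : x.1 ∈ F := x.2.resolve_right fun h =>
      absurd (hxy.lt.trans_le le_top) (by rw [show x = ⊤ from Subtype.ext h]; exact lt_irrefl _)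
    have : l ⁻¹' branch (SimpleGraph.hasse τ) x y = x.1 := by
      rw [branch_hasse hlam hxy]
      ext w
      rw [Set.mem_preimage, Set.mem_Iic, hle]
      by_cases hw : w = b
      · rw [hw, lb]
        refine ⟨fun h => absurd (Set.univ_subset_iff.1 h) (hFne _ hxF),
          fun h => absurd h (hFb _ hxF)⟩
      · rw [ls w hw, Set.singleton_subset_iff]
    rw [this]
    exact hF.prop _ hxF
  refine ⟨D, fun i j hij => ?_⟩
  obtain ⟨x, y, hxy, hs⟩ := hD i j hij
  rcases SimpleGraph.hasse_adj.1 hxy with h | h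
  · exact Or.inl (hs ▸ hpre x y h)
  -- Traversed downwards, the edge has the complement of a member as its shore.
  · right
    rw [hs, ← Set.preimage_compl, branch_compl hT hxy]
    exact hpre y x h

lemma exists_decomposition_of_subsingleton {W : Type u} [Subsingleton W] [Nonempty W] :
    ∃ D : Decomposition W, ∀ i j, ¬ D.T.Adj i j := by
  obtain ⟨w⟩ := ‹Nonempty W›
  have hT : (⊥ : SimpleGraph Unit).IsTree :=
    ⟨⟨fun _ _ => .refl _⟩, by simp⟩
  obtain ⟨D, hD⟩ := exists_decomposition_of_tree (W := W) ⊥ hT (by simp) (fun _ => ())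
    (fun _ _ _ => Subsingleton.elim _ _) (fun t => by simp)
  refine ⟨D, fun i j hij => ?_⟩
  obtain ⟨a, b, hab, -⟩ := hD i j hij
  exact hab

/-! ### The width bound -/

lemma IsLift.exists_decomposition {V : Type u} {W : Type v} [Finite W] [Nontrivial W]
    {G : SimpleGraph V} {H : SimpleGraph W} {c : V → Bool} {c' : W → Bool} {m : V → V}
    {m' : W → W} {ι : W → V} (hc : IsColouring G c) (hc' : IsColouring H c') (hm' : IsMate H m')
    (hι : IsLift G H c c' m m' ι) (D : Decomposition V) :
    ∃ D' : Decomposition W, D'.width H ≤ 2 * D.width G := by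
  have : Nontrivial V := hι.injective.nontrivial
  let k := D.width G
  let P : Set V → Prop := fun X => matchingPorosity G X ≤ k
  let Q : Set W → Prop := fun Y => matchingPorosity H Y ≤ 2 * k
  have hshore : ∀ t t', D.T.Adj t t' → P (D.shore t t') := fun t t' h =>
    le_iSup_of_le t (le_iSup_of_le t' (le_iSup_of_le h le_rfl))
  have hgood := D.good_compl_singleton hshore
  have hQc : ∀ Y, Q Y → Q Yᶜ := fun Y h => by
    simpa only [Q, matchingPorosity_compl] using h
  have hQs : ∀ w, Q {w} := fun w => by
    -- Singletons are shores, so the width of `D` is at least one; this pays for splitting the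
    -- fibres.
    have h1 : 1 ≤ k := (one_le_matchingPorosity_singleton hc hι.mate (ι w)).trans (hgood (ι w)).1
    exact (matchingPorosity_singleton_le hc' w).trans
      (h1.trans (by rw [two_mul]; exact le_self_add))
  -- `φ` identifies the ends of every edge of the perfect matching `m'`
  let φ : W → V := fun w => if c' w then ι w else ι (m' w)
  have hφ_true : ∀ w, c' w = true → φ w = ι w := fun w hw => by simp [φ, hw]
  have hφ_m : ∀ w, φ (m' w) = φ w := fun w => by
    have := hc' _ _ (hm'.adj w)
    cases hw : c' w <;> simp [φ, hw, this, hm'.invol]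
  have hφ_inj : ∀ w w', φ w = φ w' → w' = w ∨ w' = m' w := by
    intro w w' h
    simp only [φ] at h
    split_ifs at h
    · exact Or.inl (hι.injective h).symm
    · exact Or.inr (by rw [hι.injective h, hm'.invol])
    · exact Or.inr (hι.injective h).symm
    · exact Or.inl (hm'.injective (hι.injective h)).symm
  have hfib : ∀ w, φ ⁻¹' {φ w} = {w} ∪ {m' w} := by
    intro w
    ext w'
    constructor
    · exact fun h => hφ_inj w w' (Eq.symm h)
    · rintro (rfl | rfl)
      exacts [rfl, hφ_m w]
  have hPQ : ∀ X, P X → Q (φ ⁻¹' X) := by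
    intro X hX
    refine matchingPorosity_le hc' fun n' hn' => ?_
    obtain ⟨n, hn, hcr⟩ := hι.lift n' hn'
    -- For `a` of colour `true`, `n' a` has colour `false`, so `φ` sends it to the image of its
    -- `m'`-partner.
    have heq : crossing c' n' (φ ⁻¹' X) = crossing c' (m' ∘ n') (ι ⁻¹' X) := by
      refine congrArg Set.encard (Set.ext fun a => and_congr_right fun ha => ?_)
      simp only [Set.mem_preimage, hφ_true a ha]
      rw [← hφ_m (n' a), hφ_true _ (by rw [hc' _ _ (hm'.adj _), hc' _ _ (hn'.adj _), ha]; rfl)]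
      rfl
    rw [heq, two_mul]
    exact (hcr X).trans ((crossing_comp_le hc hι.mate hn X).trans (add_le_add
      ((crossing_le_matchingPorosity hc hn X).trans hX)
      ((crossing_le_matchingPorosity hc hι.mate X).trans hX)))
  have hfibre : ∀ v, P {v} → φ ⁻¹' {v} = ∅ ∨ Good Q (φ ⁻¹' {v}) := by
    intro v hv
    rcases Set.eq_empty_or_nonempty (φ ⁻¹' {v}) with h | ⟨w, rfl⟩
    · exact Or.inl h
    · right
      have := hPQ _ hv
      rw [hfib] at this ⊢
      refine (Good.single w (hQs w)).union (Good.single _ (hQs _)) ?_ this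
      exact Set.disjoint_singleton.2 (hm'.adj w).ne
  obtain ⟨b⟩ : Nonempty W := inferInstance
  have hb : Good Q {b}ᶜ := by
    -- The new tree is rooted at `b`. The complement of the fibre `{b, m' b}` is good by pulling
    -- back, and `m' b` is then added as a further singleton.
    have hU : {m' b} ∪ φ ⁻¹' {φ b}ᶜ = {b}ᶜ := by
      rw [Set.preimage_compl, hfib]
      ext w
      have := (hm'.adj b).ne
      simp only [Set.mem_union, Set.mem_singleton_iff, Set.mem_compl_iff]
      by_cases h : w = m' b
      · simp [h, this.symm]
      · simp [h]
    rcases Good.preimage hPQ hfibre (hgood (φ b)).2 with h | h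
    -- Here `b` and `m' b` are the only vertices of `H`.
    · rw [h, Set.union_empty] at hU
      rw [← hU]
      exact Good.single _ (hQs _)
    · refine (Good.single (m' b) (hQs _)).union_eq h ?_ hU (hQc _ (hQs b))
      rw [Set.disjoint_singleton_left]
      exact fun h => h (hφ_m b)
  obtain ⟨F, hF⟩ := hb.exists_family
  obtain ⟨D', hD'⟩ := hF.exists_decomposition
  refine ⟨D', iSup_le fun i => iSup_le fun j => iSup_le fun hij => ?_⟩
  rcases hD' i j hij with h | h
  · exact h
  · have := hQc _ h
    rwa [compl_compl] at this

end PMWidth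

theorem mainTheorem7 {V : Type u} {W : Type v} [Finite V] [Finite W]
    (G : SimpleGraph V) (H : SimpleGraph W)
    (hG : PMWidth.MatchingCovered G) (hGb : G.IsBipartite)
    (hH : PMWidth.MatchingCovered H) (hHb : H.IsBipartite)
    (hminor : PMWidth.IsMatchingMinor H G) :
    PMWidth.pmw H ≤ 2 * PMWidth.pmw G := by
  have : Nonempty W := hH.1.nonempty
  rcases subsingleton_or_nontrivial W with hW | hW
  -- A one-vertex tree has no edges, so the supremum is over the empty set and equals `0`.
  · obtain ⟨D, hD⟩ := PMWidth.exists_decomposition_of_subsingleton (W := W)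
    have : D.width H ≤ 0 := iSup_le fun i => iSup_le fun j => iSup_le fun h => absurd h (hD i j)
    exact (iInf_le _ D).trans (this.trans (zero_le))
  obtain ⟨c, hc⟩ := PMWidth.exists_isColouring hGb
  obtain ⟨c', hc', hlifts⟩ := hminor.exists_lifts hc
  obtain ⟨w⟩ : Nonempty W := inferInstance
  obtain ⟨w', hw⟩ := hH.1.preconnected.exists_adj_of_nontrivial w
  obtain ⟨M, hM, -⟩ := hH.2 s(w, w') hw
  obtain ⟨m', hm', -⟩ := PMWidth.exists_isMate hM
  obtain ⟨m, ι, hι⟩ := hlifts m' hm'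
  rw [PMWidth.pmw, PMWidth.pmw, ENat.mul_iInf_of_ne (by norm_num)]
  refine le_iInf fun D => ?_
  obtain ⟨D', hD'⟩ := hι.exists_decomposition hc hc' hm' D
  exact (iInf_le _ D').trans hD'
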